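/- Let $q>p\ge 1$ be real numbers. There is a constant $c_{p,q}<\infty$, depending only on $(p,q)$, such that the following holds. Let $\mathcal X$ be a real Banach space with its Borel $\sigma$-algebra, and let $\rho:\mathcal X\to[0,\infty]$ be a measurable function with $\rho(ax)=|a|\rho(x)$ for all $a\in\mathbb R$, $x\in\mathcal X$ (where $0\cdot\infty=0$), and $B_0:=\{x:\rho(x)\le 1\}\subseteq\{x:\|x\|\le 1\}$. Let $\mu$ be a Borel probability measure on $\mathcal X$ such that, for $X\sim\mu$, $\|\rho(X)\|_q=(\mathbb E\,\rho(X)^q)^{1/q}=M_q<\infty$. For $n\ge 1$ let $\hat\mu=\frac1n\sum_{i=1}^n\delta_{X_i}$ be the empirical measure of independent random elements $X_1,\dots,X_n$ with law $\mu$. For $\ell\ge 0$ let $\bar N_\ell\in\mathbb N\cup\{\infty\}$ be the least number of closed balls of radius $3^{-(\ell+1)}$ with centres in $B_0$ that cover $B_0$ ($\infty$ if there is no finite cover). Then for every integer $\ell^*\ge 0$, $$\mathbb E\,W_p^p(\hat\mu,\mu)\le c_{p,q}\,M_q^p\sum_{j\ge0}2^{pj}\Big\{2^{-qj}3^{-p\ell^*}+\sum_{\ell=0}^{\ell^*}3^{-p\ell}\Big[2^{-qj}\wedge\big(\bar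 N_\ell\,2^{-qj}n^{-1}\big)^{1/2}\Big]\Big\},$$ where $W_p(\mu,\nu)=\inf_{\xi}\big(\int\|x-y\|^p\,d\xi(x,y)\big)^{1/p}$, the infimum being over all probability measures $\xi$ on $\mathcal X^2$ with marginals $\mu$ and $\nu$, and $a\wedge b=\min(a,b)$. -/

import Mathlib

open MeasureTheory ProbabilityTheory
open scoped ENNReal NNReal

universe u v

namespace WassersteinEmpirical

/-- `ξ` is a coupling of `μ` and `ν`: a measure on the product with these two marginals. -/
def IsCoupling {E : Type*} [MeasurableSpace E] (ξ : Measure (E × E)) (μ ν : Measure E) : Prop :=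
  ξ.map Prod.fst = μ ∧ ξ.map Prod.snd = ν

/-- The Wasserstein distance of order `p` on a normed space,
`W_p(μ, ν) = inf_ξ (∫ ‖x - y‖ ^ p dξ(x, y)) ^ (1 / p)` over all couplings `ξ` of `μ` and `ν`,
with values in `[0, ∞]`. -/
noncomputable def wasserstein {E : Type*} [NormedAddCommGroup E] [MeasurableSpace E]
    (p : ℝ) (μ ν : Measure E) : ℝ≥0∞ :=
  ⨅ (ξ : Measure (E × E)) (_ : IsCoupling ξ μ ν),
    (∫⁻ z, ‖z.1 - z.2‖ₑ ^ p ∂ξ) ^ (1 / p)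

/-- The empirical measure `n⁻¹ ∑ i, δ_{x i}` of `n` sample points. -/
noncomputable def empiricalMeasure {E : Type*} [MeasurableSpace E] {n : ℕ} (x : Fin n → E) :
    Measure E :=
  (n : ℝ≥0∞)⁻¹ • ∑ i, Measure.dirac (x i)

/-- `N̄_ℓ(B)`: the least number of closed balls of radius `3 ^ (-(ℓ + 1))` with centres in `B`
that cover `B` (it is `∞` if there is no finite cover). -/
noncomputable def coverNum {E : Type*} [NormedAddCommGroup E] (B : Set E) (l : ℕ) : ℝ≥0∞ :=
  ((Metric.coveringNumber ((3 : ℝ≥0)⁻¹ ^ (l + 1)) B : ℕ∞) : ℝ≥0∞)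

end WassersteinEmpirical

/-! Transport is done from fine to coarse. Along coarsening countable partitions, as much mass as
possible is first matched inside the cells of the finest one, then what is left inside the next, and
so on. Only the excess `|μ̂(A) - μ(A)|` of each cell `A` survives a step, so the next step pays the
diameter of the next coarser cells times the total excess (`exists_coupling_lintegral_le`).

The cells come from cutting the space into dyadic shells, `ρ` between `2^(j-1) M` and `2^j M`.
Dividing by the outer radius puts a shell inside `B₀`, where nearest-centre maps for coverings of
radius `3^(-(ℓ+1))`, composed from fine to coarse, give nested cells of diameter of order `3^(-ℓ)`
(`enorm_sub_le_of_cell_eq`). The coarsest partition is the whole space, where `‖x‖ ≤ ρ x` bounds the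
cost.

In expectation, the excess of a cell is at most `2 μ(A)` and, by the variance of a mean of
indicators, at most `(μ(A)/n)^(1/2)`. Summing over the at most `N̄_ℓ` cells of a shell by
Cauchy–Schwarz, and bounding the mass of the shell by Markov's inequality, gives the minimum in the
theorem; the matching inside the finest cells gives the term without covering numbers. -/

namespace WassersteinEmpirical

/-! ### Transport along coarsening partitions -/

/-- A measure is the sum of its restrictions to the fibres of a map with countably many values. -/
theorem sum_restrict_fiber {E ι : Type*} [MeasurableSpace E] [MeasurableSpace ι] [Countable ι]
    [MeasurableSingletonClass ι] (μ : Measure E) {f : E → ι} (hf : Measurable f) :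
    Measure.sum (fun i => μ.restrict (f ⁻¹' {i})) = μ := by
  rw [← Measure.restrict_iUnion (μ := μ) (s := fun i => f ⁻¹' {i})]
  · rw [← Set.preimage_iUnion, Set.iUnion_of_singleton, Set.preimage_univ, Measure.restrict_univ]
  · intro i j hij
    exact Disjoint.preimage f (by simpa using hij)
  · exact fun i => hf (measurableSet_singleton i)

theorem lintegral_comp_eq_tsum {E ι : Type*} [MeasurableSpace E] [MeasurableSpace ι] [Countable ι]
    [MeasurableSingletonClass ι] (μ : Measure E) {f : E → ι} (hf : Measurable f) (D : ι → ℝ≥0∞) :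
    ∫⁻ x, D (f x) ∂μ = ∑' i, D i * μ (f ⁻¹' {i}) := by
  rw [← lintegral_map (measurable_of_countable D) hf, lintegral_countable']
  simp_rw [Measure.map_apply hf (measurableSet_singleton _)]

theorem max_inv_mul_le_one (a b : ℝ≥0∞) : (max a b)⁻¹ * b ≤ 1 := by
  rw [mul_comm, ← div_eq_mul_inv]
  exact ENNReal.div_le_of_le_mul (by simp)

theorem one_sub_max_inv_mul_mul {a b : ℝ≥0∞} (ha : a ≠ ∞) (hb : b ≠ ∞) :
    (1 - (max a b)⁻¹ * b) * a = a - b := by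
  rcases le_total a b with h | h
  · rw [max_eq_right h, tsub_eq_zero_of_le h]
    rcases eq_or_ne b 0 with rfl | h0
    · simp [le_antisymm h zero_le]
    · rw [ENNReal.inv_mul_cancel h0 hb]; simp
  · rw [max_eq_left h, ENNReal.sub_mul (fun _ _ => ha), one_mul]
    rcases eq_or_ne a 0 with rfl | h0
    · simp
    · rw [mul_right_comm, ENNReal.inv_mul_cancel h0 ha, one_mul]

/-- Greedy transport within the fibres of `f`: a measure `ξ` concentrated on pairs in a common
fibre, whose marginals leave out of `μ` and `ν` only the excess mass of each fibre. -/
theorem exists_partial_coupling {E ι : Type*} [MeasurableSpace E] [MeasurableSpace ι] [Countable ι]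
    [MeasurableSingletonClass ι] (μ ν : Measure E) [IsFiniteMeasure μ] [IsFiniteMeasure ν]
    {f : E → ι} (hf : Measurable f) :
    ∃ (ξ : Measure (E × E)) (μ' ν' : Measure E),
      ξ.map Prod.fst + μ' = μ ∧ ξ.map Prod.snd + ν' = ν ∧
      (∀ᵐ z ∂ξ, f z.1 = f z.2) ∧
      (∀ i, μ' (f ⁻¹' {i}) = μ (f ⁻¹' {i}) - ν (f ⁻¹' {i})) ∧
      (∀ i, ν' (f ⁻¹' {i}) = ν (f ⁻¹' {i}) - μ (f ⁻¹' {i})) := by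
  set A : ι → Set E := fun i => f ⁻¹' {i} with hA
  have hAm : ∀ i, MeasurableSet (A i) := fun i => hf (measurableSet_singleton i)
  have hres : ∀ (w : ι → ℝ≥0∞) (m : Measure E) (i : ι),
      Measure.sum (fun j => w j • m.restrict (A j)) (A i) = w i * m (A i) := by
    intro w m i
    rw [Measure.sum_apply _ (hAm i), tsum_eq_single i]
    · simp
    · intro j hj
      have : A i ∩ A j = ∅ := by
        ext x; simp only [hA, Set.mem_inter_iff, Set.mem_preimage, Set.mem_singleton_iff,
          Set.mem_empty_iff_false, iff_false, not_and]
        intro h1 h2; exact hj (h2.symm.trans h1)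
      simp [Measure.restrict_apply (hAm i), this]
  -- In each fibre, the product measure is divided by the larger of the two masses, so the lighter
  -- measure is used up entirely. If both masses vanish, the weight `∞` multiplies the zero measure.
  refine ⟨Measure.sum fun i => (max (μ (A i)) (ν (A i)))⁻¹ •
      (μ.restrict (A i)).prod (ν.restrict (A i)),
    Measure.sum fun i => (1 - (max (μ (A i)) (ν (A i)))⁻¹ * ν (A i)) • μ.restrict (A i),
    Measure.sum fun i => (1 - (max (μ (A i)) (ν (A i)))⁻¹ * μ (A i)) • ν.restrict (A i),
    ?_, ?_, ?_, ?_, ?_⟩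
  · rw [Measure.map_sum measurable_fst.aemeasurable, Measure.sum_add_sum]
    conv_rhs => rw [← sum_restrict_fiber μ hf]
    congr 1; ext1 i
    rw [Measure.map_smul, Measure.map_fst_prod, Measure.restrict_apply_univ, smul_smul, ← add_smul,
      add_tsub_cancel_of_le (max_inv_mul_le_one _ _), one_smul]
  · rw [Measure.map_sum measurable_snd.aemeasurable, Measure.sum_add_sum]
    conv_rhs => rw [← sum_restrict_fiber ν hf]
    congr 1; ext1 i
    rw [Measure.map_smul, Measure.map_snd_prod, Measure.restrict_apply_univ, smul_smul, ← add_smul,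
      max_comm, add_tsub_cancel_of_le (max_inv_mul_le_one _ _), one_smul]
  · rw [Measure.ae_sum_iff]
    intro i
    refine Measure.ae_smul_measure ?_ _
    rw [Measure.prod_restrict]
    filter_upwards [ae_restrict_mem ((hAm i).prod (hAm i))] with z hz
    exact hz.1.trans hz.2.symm
  · intro i
    rw [hres, one_sub_max_inv_mul_mul (measure_ne_top _ _) (measure_ne_top _ _)]
  · intro i
    rw [hres, max_comm, one_sub_max_inv_mul_mul (measure_ne_top _ _) (measure_ne_top _ _)]

/-- Equal masses may be taken off two measures without changing their truncated difference. -/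
theorem residual_sub {E ι : Type*} [MeasurableSpace E] [MeasurableSpace ι]
    [MeasurableSingletonClass ι] {μ ν μ' ν' : Measure E} [IsFiniteMeasure μ]
    {ξ : Measure (E × E)} {f : E → ι} (hf : Measurable f)
    (h1 : ξ.map Prod.fst + μ' = μ) (h2 : ξ.map Prod.snd + ν' = ν)
    (h : ∀ᵐ z ∂ξ, f z.1 = f z.2) (i : ι) :
    μ' (f ⁻¹' {i}) - ν' (f ⁻¹' {i}) = μ (f ⁻¹' {i}) - ν (f ⁻¹' {i}) ∧
    ν' (f ⁻¹' {i}) - μ' (f ⁻¹' {i}) = ν (f ⁻¹' {i}) - μ (f ⁻¹' {i}) := by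
  have hm := hf (measurableSet_singleton i)
  have e : ξ.map Prod.fst (f ⁻¹' {i}) = ξ.map Prod.snd (f ⁻¹' {i}) := by
    rw [Measure.map_apply measurable_fst hm, Measure.map_apply measurable_snd hm]
    refine measure_congr ?_
    filter_upwards [h] with z hz
    simp only [Set.preimage, Set.mem_singleton_iff, eq_iff_iff]
    change f z.1 = i ↔ f z.2 = i
    rw [hz]
  have hfin : ξ.map Prod.fst (f ⁻¹' {i}) ≠ ∞ := by
    refine ne_top_of_le_ne_top (measure_ne_top μ (f ⁻¹' {i})) ?_
    rw [← h1]; simp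
  rw [← h1, ← h2, Measure.add_apply, Measure.add_apply, ← e,
    ENNReal.add_sub_add_eq_sub_left hfin, ENNReal.add_sub_add_eq_sub_left hfin]
  exact ⟨rfl, rfl⟩

/-- A cost that splits into a function of each endpoint sees `ξ` only through its marginals, which
are dominated by `μ` and `ν`. -/
theorem lintegral_le_of_common_fiber {E ι : Type*} [MeasurableSpace E]
    {μ μ' ν ν' : Measure E} {ξ : Measure (E × E)} {f : E → ι}
    (h1 : ξ.map Prod.fst + μ' = μ) (h2 : ξ.map Prod.snd + ν' = ν)
    (h : ∀ᵐ z ∂ξ, f z.1 = f z.2) {c : E × E → ℝ≥0∞} {G : E → ℝ≥0∞} (hG : Measurable G)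
    (hc : ∀ x y, f x = f y → c (x, y) ≤ G x + G y) :
    ∫⁻ z, c z ∂ξ ≤ ∫⁻ x, G x ∂μ + ∫⁻ x, G x ∂ν := by
  calc ∫⁻ z, c z ∂ξ ≤ ∫⁻ z, (G z.1 + G z.2) ∂ξ := by
        refine lintegral_mono_ae ?_
        filter_upwards [h] with z hz using hc _ _ hz
    _ = ∫⁻ x, G x ∂(ξ.map Prod.fst) + ∫⁻ x, G x ∂(ξ.map Prod.snd) := by
        rw [lintegral_add_left (f := fun z : E × E => G z.1) (hG.comp measurable_fst),
          lintegral_map hG measurable_fst,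
          lintegral_map hG measurable_snd]
    _ ≤ _ := by
        gcongr
        · rw [← h1]; exact Measure.le_add_right le_rfl
        · rw [← h2]; exact Measure.le_add_right le_rfl

/-- Multiscale transport along a chain of coarser and coarser countable partitions, the fibres of
`f 0, …, f K`, the last of which is trivial. -/
theorem exists_coupling_lintegral_le {E ι : Type*} [MeasurableSpace E] [MeasurableSpace ι]
    [Countable ι] [MeasurableSingletonClass ι] (μ ν : Measure E) [IsProbabilityMeasure μ]
    [IsProbabilityMeasure ν] {f : ℕ → E → ι} (hf : ∀ k, Measurable (f k))
    (hfac : ∀ k x y, f k x = f k y → f (k + 1) x = f (k + 1) y) {K : ℕ}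
    (hK : ∀ x y, f K x = f K y) {c : E × E → ℝ≥0∞} {G : E → ℝ≥0∞} (hG : Measurable G)
    (hc0 : ∀ x y, f 0 x = f 0 y → c (x, y) ≤ G x + G y) {D : ℕ → ι → ℝ≥0∞}
    (hc : ∀ k < K, ∀ x y, f (k + 1) x = f (k + 1) y → c (x, y) ≤ D k (f k x) + D k (f k y)) :
    ∃ ξ : Measure (E × E), IsCoupling ξ μ ν ∧ ∫⁻ z, c z ∂ξ ≤
      ∫⁻ x, G x ∂μ + ∫⁻ x, G x ∂ν + ∑ k ∈ Finset.range K, ∑' i, D k i *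
        ((μ (f k ⁻¹' {i}) - ν (f k ⁻¹' {i})) + (ν (f k ⁻¹' {i}) - μ (f k ⁻¹' {i}))) := by
  -- The invariant: after step `m` the unmatched masses of each cell are exactly the two truncated
  -- differences, whatever was matched before.
  have main : ∀ m ≤ K, ∃ (ξ : Measure (E × E)) (μ' ν' : Measure E),
      ξ.map Prod.fst + μ' = μ ∧ ξ.map Prod.snd + ν' = ν ∧
      (∀ᵐ z ∂ξ, f m z.1 = f m z.2) ∧
      (∀ i, μ' (f m ⁻¹' {i}) = μ (f m ⁻¹' {i}) - ν (f m ⁻¹' {i})) ∧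
      (∀ i, ν' (f m ⁻¹' {i}) = ν (f m ⁻¹' {i}) - μ (f m ⁻¹' {i})) ∧
      ∫⁻ z, c z ∂ξ ≤ ∫⁻ x, G x ∂μ + ∫⁻ x, G x ∂ν + ∑ k ∈ Finset.range m, ∑' i, D k i *
        ((μ (f k ⁻¹' {i}) - ν (f k ⁻¹' {i})) + (ν (f k ⁻¹' {i}) - μ (f k ⁻¹' {i}))) := by
    intro m
    induction m with
    | zero =>
      intro _
      obtain ⟨ξ, μ', ν', h1, h2, h3, h4, h5⟩ := exists_partial_coupling μ ν (hf 0)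
      exact ⟨ξ, μ', ν', h1, h2, h3, h4, h5,
        by simpa using lintegral_le_of_common_fiber h1 h2 h3 hG hc0⟩
    | succ m ih =>
      intro hm
      obtain ⟨ξ, μ', ν', h1, h2, h3, h4, h5, h6⟩ := ih (by omega)
      have hle1 : μ' ≤ μ := by rw [← h1]; exact Measure.le_add_left le_rfl
      have hle2 : ν' ≤ ν := by rw [← h2]; exact Measure.le_add_left le_rfl
      have : IsFiniteMeasure μ' := isFiniteMeasure_of_le μ hle1
      have : IsFiniteMeasure ν' := isFiniteMeasure_of_le ν hle2
      obtain ⟨η, μ₂, ν₂, g1, g2, g3, g4, g5⟩ := exists_partial_coupling μ' ν' (hf (m + 1))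
      have h3' : ∀ᵐ z ∂ξ, f (m + 1) z.1 = f (m + 1) z.2 := by
        filter_upwards [h3] with z hz using hfac m _ _ hz
      refine ⟨ξ + η, μ₂, ν₂, ?_, ?_, ?_, ?_, ?_, ?_⟩
      · rw [Measure.map_add _ _ measurable_fst, add_assoc, g1, h1]
      · rw [Measure.map_add _ _ measurable_snd, add_assoc, g2, h2]
      · exact ae_add_measure_iff.2 ⟨h3', g3⟩
      · intro i
        rw [g4, (residual_sub (hf (m + 1)) h1 h2 h3' i).1]
      · intro i
        rw [g5, (residual_sub (hf (m + 1)) h1 h2 h3' i).2]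
      · rw [lintegral_add_measure, Finset.sum_range_succ, ← add_assoc]
        refine add_le_add h6 ?_
        -- Only residuals move now. The bound on the cost is constant on the cells of step `m`,
        -- whose residual masses the invariant gives.
        refine (lintegral_le_of_common_fiber g1 g2 g3
          ((measurable_of_countable (D m)).comp (hf m)) (hc m (by omega))).trans ?_
        simp only [Function.comp_apply]
        rw [lintegral_comp_eq_tsum _ (hf m), lintegral_comp_eq_tsum _ (hf m), ← ENNReal.tsum_add]
        simp_rw [h4, h5, mul_add]
        exact le_rfl
  obtain ⟨ξ, μ', ν', h1, h2, h3, h4, h5, h6⟩ := main K le_rfl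
  -- The last partition has one cell, of mass `1` for both measures, so nothing is left over.
  have : Nonempty E := μ.nonempty_of_neZero
  obtain ⟨x₀⟩ := ‹Nonempty E›
  have hu : f K ⁻¹' {f K x₀} = Set.univ := by
    ext x; simpa using hK x x₀
  have e1 : μ' = 0 := by
    have := h4 (f K x₀)
    rw [hu] at this
    simpa using this
  have e2 : ν' = 0 := by
    have := h5 (f K x₀)
    rw [hu] at this
    simpa using this
  refine ⟨ξ, ⟨?_, ?_⟩, h6⟩
  · simpa [e1] using h1
  · simpa [e2] using h2

/-- The Wasserstein distance is bounded by the cost of a multiscale transport. -/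
theorem wasserstein_rpow_le {E ι : Type*} [NormedAddCommGroup E] [MeasurableSpace E]
    [MeasurableSpace ι] [Countable ι] [MeasurableSingletonClass ι] {p : ℝ} (hp : 0 < p)
    (μ ν : Measure E) [IsProbabilityMeasure μ]
    [IsProbabilityMeasure ν] {f : ℕ → E → ι} (hf : ∀ k, Measurable (f k))
    (hfac : ∀ k x y, f k x = f k y → f (k + 1) x = f (k + 1) y) {K : ℕ}
    (hK : ∀ x y, f K x = f K y) {G : E → ℝ≥0∞} (hG : Measurable G)
    (hc0 : ∀ x y, f 0 x = f 0 y → ‖x - y‖ₑ ^ p ≤ G x + G y) {D : ℕ → ι → ℝ≥0∞}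
    (hc : ∀ k < K, ∀ x y, f (k + 1) x = f (k + 1) y →
      ‖x - y‖ₑ ^ p ≤ D k (f k x) + D k (f k y)) :
    wasserstein p μ ν ^ p ≤
      ∫⁻ x, G x ∂μ + ∫⁻ x, G x ∂ν + ∑ k ∈ Finset.range K, ∑' i, D k i *
        ((μ (f k ⁻¹' {i}) - ν (f k ⁻¹' {i})) + (ν (f k ⁻¹' {i}) - μ (f k ⁻¹' {i}))) := by
  obtain ⟨ξ, hξ, hle⟩ := exists_coupling_lintegral_le (c := fun z => ‖z.1 - z.2‖ₑ ^ p)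
    μ ν hf hfac hK hG hc0 hc
  refine le_trans ?_ hle
  calc wasserstein p μ ν ^ p ≤ ((∫⁻ z, ‖z.1 - z.2‖ₑ ^ p ∂ξ) ^ (1 / p)) ^ p :=
        ENNReal.rpow_le_rpow (iInf₂_le ξ hξ) hp.le
    _ = _ := by rw [← ENNReal.rpow_mul, one_div, inv_mul_cancel₀ hp.ne', ENNReal.rpow_one]

/-! ### Dyadic shells -/

/-- Outer radii of the dyadic shells at scale `M`; index `0` stands for the set on which no finite
radius is large enough. -/
noncomputable def radius (M : ℝ≥0) : ℕ → ℝ≥0∞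
  | 0 => ∞
  | j + 1 => 2 ^ j * M

open Classical in
/-- The index of the dyadic shell at scale `M` that contains a point of gauge `t`. -/
noncomputable def shellIdx (M : ℝ≥0) (t : ℝ≥0∞) : ℕ :=
  if h : ∃ j : ℕ, t ≤ 2 ^ j * M then Nat.find h + 1 else 0

theorem le_radius_shellIdx (M : ℝ≥0) (t : ℝ≥0∞) : t ≤ radius M (shellIdx M t) := by
  classical
  unfold shellIdx
  split_ifs with h
  · exact Nat.find_spec h
  · exact le_top

theorem shellIdx_eq_zero_iff {M : ℝ≥0} {t : ℝ≥0∞} :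
    shellIdx M t = 0 ↔ ∀ j : ℕ, 2 ^ j * (M : ℝ≥0∞) < t := by
  classical
  unfold shellIdx
  split_ifs with h
  · obtain ⟨j, hj⟩ := h
    simp only [false_iff, not_forall, not_lt]
    exact ⟨j, hj⟩
  · simpa using h

theorem shellIdx_eq_succ_iff {M : ℝ≥0} {t : ℝ≥0∞} {j : ℕ} :
    shellIdx M t = j + 1 ↔ t ≤ 2 ^ j * M ∧ ∀ i < j, 2 ^ i * (M : ℝ≥0∞) < t := by
  classical
  unfold shellIdx
  split_ifs with h
  · rw [Nat.add_right_cancel_iff, Nat.find_eq_iff]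
    simp only [not_le]
  · exact ⟨fun h0 => h0.elim, fun h0 => absurd ⟨j, h0.1⟩ h⟩

theorem measurable_shellIdx (M : ℝ≥0) : Measurable (shellIdx M) := by
  refine measurable_to_countable' fun s => ?_
  cases s with
  | zero =>
    have : shellIdx M ⁻¹' {0} = ⋂ j : ℕ, Set.Ioi (2 ^ j * (M : ℝ≥0∞)) := by
      ext t; simp [shellIdx_eq_zero_iff]
    rw [this]
    exact MeasurableSet.iInter fun _ => measurableSet_Ioi
  | succ j =>
    have : shellIdx M ⁻¹' {j + 1} =
        Set.Iic (2 ^ j * (M : ℝ≥0∞)) ∩ ⋂ i : ℕ, ⋂ _ : i < j, Set.Ioi (2 ^ i * (M : ℝ≥0∞)) := by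
      ext t; simp [shellIdx_eq_succ_iff]
    rw [this]
    exact measurableSet_Iic.inter
      (MeasurableSet.iInter fun _ => MeasurableSet.iInter fun _ => measurableSet_Ioi)

/-! ### Nested cells from nearest-centre maps -/

section Nested

variable {E : Type*} [NormedAddCommGroup E] [MeasurableSpace E] [BorelSpace E]

/-- Cell indices of a nested sequence of partitions: `x` is sent to the nearest centre of step `0`,
that centre to the nearest one of step `1`, and so on. At step `k` the centres are
`e k 0, …, e k (N k)`. -/
noncomputable def nestedIdx (e : ℕ → ℕ → E) (N : ℕ → ℕ) : ℕ → E → ℕ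
  | 0, x => SimpleFunc.nearestPtInd (e 0) (N 0) x
  | k + 1, x => SimpleFunc.nearestPtInd (e (k + 1)) (N (k + 1)) (e k (nestedIdx e N k x))

theorem measurable_nestedIdx (e : ℕ → ℕ → E) (N : ℕ → ℕ) (k : ℕ) :
    Measurable (nestedIdx e N k) := by
  induction k with
  | zero => exact (SimpleFunc.nearestPtInd (e 0) (N 0)).measurable
  | succ k ih =>
    exact (measurable_of_countable
      (fun m => SimpleFunc.nearestPtInd (e (k + 1)) (N (k + 1)) (e k m))).comp ih

theorem nestedIdx_le (e : ℕ → ℕ → E) (N : ℕ → ℕ) (k : ℕ) (x : E) : nestedIdx e N k x ≤ N k := by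
  cases k <;> exact SimpleFunc.nearestPtInd_le _ _ _

theorem dist_nearestPtInd_le {e : ℕ → E} {N : ℕ} {x : E} {δ : ℝ}
    (h : ∃ m ≤ N, dist x (e m) ≤ δ) : dist x (e (SimpleFunc.nearestPtInd e N x)) ≤ δ := by
  obtain ⟨m, hm, hd⟩ := h
  refine le_trans ?_ hd
  have := SimpleFunc.edist_nearestPt_le e x hm
  rw [edist_dist, edist_dist, ENNReal.ofReal_le_ofReal_iff dist_nonneg] at this
  rw [dist_comm, dist_comm x]
  exact this

/-- Each centre lies in `B`, so the next covering applies to it. The displacements sum to `(1 + 3 +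
⋯ + 3^k) / 3^K`, which is below half of `3^(k+1) / 3^K`. -/
theorem dist_nestedIdx_le {e : ℕ → ℕ → E} {N : ℕ → ℕ} {B : Set E} {K : ℕ}
    (heB : ∀ k < K, ∀ m, e k m ∈ B)
    (he : ∀ k < K, ∀ x ∈ B, ∃ m ≤ N k, dist x (e k m) ≤ 3 ^ k / 3 ^ K) {x : E} (hx : x ∈ B)
    {k : ℕ} (hk : k < K) : dist x (e k (nestedIdx e N k x)) ≤ 3 ^ (k + 1) / 3 ^ K / 2 := by
  induction k with
  | zero =>
    refine (dist_nearestPtInd_le (he 0 hk x hx)).trans ?_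
    have : (0 : ℝ) < 1 / 3 ^ K := by positivity
    have e1 : (3 : ℝ) ^ (0 + 1) / 3 ^ K / 2 = 3 / 2 * (1 / 3 ^ K) := by ring
    rw [e1, pow_zero]; linarith
  | succ k ih =>
    refine (dist_triangle _ _ _).trans (add_le_add (ih (by omega))
      (dist_nearestPtInd_le (he (k + 1) hk _ (heB k (by omega) _))) |>.trans ?_)
    apply le_of_eq; ring

end Nested

/-! ### Gauge and cells of the shells -/

section Gauge

variable {E : Type*} [NormedAddCommGroup E] [NormedSpace ℝ E] {ρ : E → ℝ≥0∞}

theorem gauge_inv_smul_le_one (hρ : ∀ (a : ℝ) (x : E), ρ (a • x) = ENNReal.ofReal |a| * ρ x)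
    {a : ℝ} {x : E} (hx : ρ x ≤ ENNReal.ofReal a) : ρ (a⁻¹ • x) ≤ 1 := by
  rw [hρ]
  rcases le_or_gt a 0 with ha | ha
  · rw [ENNReal.ofReal_of_nonpos ha] at hx
    simp [le_antisymm hx zero_le]
  · rw [abs_of_pos (inv_pos.2 ha), ENNReal.ofReal_inv_of_pos ha, mul_comm, ← div_eq_mul_inv]
    exact ENNReal.div_le_of_le_mul (by simpa using hx)

/-- By homogeneity, from the inclusion of the unit balls applied to `x / a` with `a` slightly above
`ρ x`; the slack covers `ρ x = 0`. -/
theorem enorm_le_gauge (hρ : ∀ (a : ℝ) (x : E), ρ (a • x) = ENNReal.ofReal |a| * ρ x)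
    (hB : {x : E | ρ x ≤ 1} ⊆ Metric.closedBall 0 1) (x : E) : ‖x‖ₑ ≤ ρ x := by
  refine ENNReal.le_of_forall_pos_le_add fun ε hε hx => ?_
  set a : ℝ := (ρ x).toReal + ε with ha
  have ha0 : 0 < a := by positivity
  have hxa : ρ x ≤ ENNReal.ofReal a := by
    rw [ha, ENNReal.ofReal_add ENNReal.toReal_nonneg ε.coe_nonneg, ENNReal.ofReal_toReal hx.ne]
    exact le_self_add
  have h1 : ‖a⁻¹ • x‖ ≤ 1 := by simpa using hB (gauge_inv_smul_le_one hρ hxa)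
  rw [norm_smul, norm_inv, Real.norm_of_nonneg ha0.le, inv_mul_le_iff₀ ha0, mul_one] at h1
  calc ‖x‖ₑ = ENNReal.ofReal ‖x‖ := (ofReal_norm x).symm
    _ ≤ ENNReal.ofReal a := ENNReal.ofReal_le_ofReal h1
    _ = ρ x + ε := by
      rw [ha, ENNReal.ofReal_add ENNReal.toReal_nonneg ε.coe_nonneg, ENNReal.ofReal_toReal hx.ne]
      simp

theorem gauge_zero (hρ : ∀ (a : ℝ) (x : E), ρ (a • x) = ENNReal.ofReal |a| * ρ x) : ρ 0 = 0 := by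
  simpa using hρ 0 0

theorem enorm_le_radius (hρ : ∀ (a : ℝ) (x : E), ρ (a • x) = ENNReal.ofReal |a| * ρ x)
    (hB : {x : E | ρ x ≤ 1} ⊆ Metric.closedBall 0 1) (M : ℝ≥0) (x : E) :
    ‖x‖ₑ ≤ radius M (shellIdx M (ρ x)) :=
  (enorm_le_gauge hρ hB x).trans (le_radius_shellIdx _ _)

/-- This serves the trivial coarsest partition, where the two points may lie in different shells. -/
theorem enorm_sub_rpow_le_add (hρ : ∀ (a : ℝ) (x : E), ρ (a • x) = ENNReal.ofReal |a| * ρ x)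
    (hB : {x : E | ρ x ≤ 1} ⊆ Metric.closedBall 0 1) (M : ℝ≥0) {p : ℝ} (hp : 0 < p) {δ : ℝ≥0∞}
    (hδ : 2 ≤ δ) (x y : E) :
    ‖x - y‖ₑ ^ p ≤ (radius M (shellIdx M (ρ x)) * δ) ^ p +
      (radius M (shellIdx M (ρ y)) * δ) ^ p := by
  wlog h : radius M (shellIdx M (ρ y)) ≤ radius M (shellIdx M (ρ x)) generalizing x y
  · rw [enorm_sub_rev, add_comm]
    exact this y x (le_of_not_ge h)
  refine le_trans (ENNReal.rpow_le_rpow ?_ hp.le) le_self_add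
  calc ‖x - y‖ₑ ≤ ‖x‖ₑ + ‖y‖ₑ := enorm_sub_le
    _ ≤ radius M (shellIdx M (ρ x)) + radius M (shellIdx M (ρ x)) :=
      add_le_add (enorm_le_radius hρ hB M x) ((enorm_le_radius hρ hB M y).trans h)
    _ = radius M (shellIdx M (ρ x)) * 2 := (mul_two _).symm
    _ ≤ _ := by gcongr

variable [MeasurableSpace E] [BorelSpace E]

/-- The label of the cell at step `k`: the shell, and the index of the nested cell of the point
rescaled by the radius of its shell. -/
noncomputable def cell (ρ : E → ℝ≥0∞) (M : ℝ≥0) (e : ℕ → ℕ → E) (N : ℕ → ℕ) (k : ℕ) (x : E) :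
    ℕ × ℕ :=
  (shellIdx M (ρ x), nestedIdx e N k ((radius M (shellIdx M (ρ x))).toReal⁻¹ • x))

theorem measurable_cell (hρm : Measurable ρ) (M : ℝ≥0) (e : ℕ → ℕ → E) (N : ℕ → ℕ) (k : ℕ) :
    Measurable (cell ρ M e N k) := by
  refine measurable_to_countable' fun i => ?_
  have : cell ρ M e N k ⁻¹' {i} = (fun x => shellIdx M (ρ x)) ⁻¹' {i.1} ∩
      (fun x => nestedIdx e N k ((radius M i.1).toReal⁻¹ • x)) ⁻¹' {i.2} := by
    ext x
    simp only [cell, Set.mem_preimage, Set.mem_singleton_iff, Set.mem_inter_iff, Prod.ext_iff]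
    constructor
    · rintro ⟨h1, h2⟩; exact ⟨h1, by rw [← h1]; exact h2⟩
    · rintro ⟨h1, h2⟩; exact ⟨h1, by rw [h1]; exact h2⟩
  rw [this]
  exact (((measurable_shellIdx M).comp hρm) (measurableSet_singleton _)).inter
    (((measurable_nestedIdx e N k).comp (measurable_const_smul _)) (measurableSet_singleton _))

theorem cell_succ_eq {M : ℝ≥0} {e : ℕ → ℕ → E} {N : ℕ → ℕ} {k : ℕ} {x y : E}
    (h : cell ρ M e N k x = cell ρ M e N k y) :
    cell ρ M e N (k + 1) x = cell ρ M e N (k + 1) y := by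
  simp only [cell, Prod.mk.injEq] at h ⊢
  refine ⟨h.1, ?_⟩
  simp only [nestedIdx]
  rw [h.2]

/-- After division by the shell radius, both points lie in `B₀` within half the stated distance of
the same centre. -/
theorem enorm_sub_le_of_cell_eq
    (hρ : ∀ (a : ℝ) (x : E), ρ (a • x) = ENNReal.ofReal |a| * ρ x)
    (hB : {x : E | ρ x ≤ 1} ⊆ Metric.closedBall 0 1) {M : ℝ≥0} {e : ℕ → ℕ → E} {N : ℕ → ℕ} {K : ℕ}
    (heB : ∀ k < K, ∀ m, e k m ∈ {x | ρ x ≤ 1})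
    (he : ∀ k < K, ∀ x ∈ {x | ρ x ≤ 1}, ∃ m ≤ N k, dist x (e k m) ≤ 3 ^ k / 3 ^ K) {k : ℕ}
    (hk : k < K) {x y : E} (h : cell ρ M e N k x = cell ρ M e N k y) :
    ‖x - y‖ₑ ≤ radius M (shellIdx M (ρ x)) * ENNReal.ofReal (3 ^ (k + 1) / 3 ^ K) := by
  simp only [cell, Prod.mk.injEq] at h
  obtain ⟨h1, h2⟩ := h
  rw [← h1] at h2
  rcases eq_or_ne (radius M (shellIdx M (ρ x))) ∞ with ht | ht
  · rw [ht, ENNReal.top_mul (by simp)]; exact le_top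
  set a : ℝ := (radius M (shellIdx M (ρ x))).toReal with ha
  have ha0 : 0 ≤ a := ENNReal.toReal_nonneg
  have hra : radius M (shellIdx M (ρ x)) = ENNReal.ofReal a := (ENNReal.ofReal_toReal ht).symm
  have hx : ρ x ≤ ENNReal.ofReal a := hra ▸ le_radius_shellIdx M (ρ x)
  have hy : ρ y ≤ ENNReal.ofReal a := by rw [← hra, h1]; exact le_radius_shellIdx M (ρ y)
  -- The radius is `0` when `M = 0`; then `a⁻¹ = 0`, but the points are `0` as well.
  have hsmul : ∀ z : E, ρ z ≤ ENNReal.ofReal a → a • a⁻¹ • z = z := by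
    intro z hz
    rcases ha0.eq_or_lt with h0 | h0
    · rw [← h0, ENNReal.ofReal_zero] at hz
      have : z = 0 := by
        rw [← enorm_eq_zero]
        exact le_antisymm ((enorm_le_gauge hρ hB z).trans hz) zero_le
      simp [this]
    · rw [smul_inv_smul₀ h0.ne']
  have d1 := dist_nestedIdx_le heB he (gauge_inv_smul_le_one hρ hx) hk
  have d2 := dist_nestedIdx_le heB he (gauge_inv_smul_le_one hρ hy) hk
  rw [← h2] at d2
  have d3 : ‖a⁻¹ • x - a⁻¹ • y‖ ≤ 3 ^ (k + 1) / 3 ^ K := by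
    rw [← dist_eq_norm]
    linarith [dist_triangle_right (a⁻¹ • x) (a⁻¹ • y) (e k (nestedIdx e N k (a⁻¹ • x)))]
  have d4 : ‖x - y‖ ≤ a * (3 ^ (k + 1) / 3 ^ K) := by
    calc ‖x - y‖ = ‖a • (a⁻¹ • x - a⁻¹ • y)‖ := by rw [smul_sub, hsmul x hx, hsmul y hy]
      _ = a * ‖a⁻¹ • x - a⁻¹ • y‖ := by rw [norm_smul, Real.norm_of_nonneg ha0]
      _ ≤ _ := by gcongr
  rw [← ofReal_norm, hra, ← ENNReal.ofReal_mul ha0]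
  exact ENNReal.ofReal_le_ofReal d4

/-- The multiscale bound on the Wasserstein distance for the cells of dyadic shells. -/
theorem wasserstein_rpow_le_cells (hρm : Measurable ρ)
    (hρ : ∀ (a : ℝ) (x : E), ρ (a • x) = ENNReal.ofReal |a| * ρ x)
    (hB : {x : E | ρ x ≤ 1} ⊆ Metric.closedBall 0 1) (M : ℝ≥0) {e : ℕ → ℕ → E} {N : ℕ → ℕ} {K : ℕ}
    (heB : ∀ k < K, ∀ m, e k m ∈ {x | ρ x ≤ 1})
    (he : ∀ k < K, ∀ x ∈ {x | ρ x ≤ 1}, ∃ m ≤ N k, dist x (e k m) ≤ 3 ^ k / 3 ^ K)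
    {p : ℝ} (hp : 0 < p) (μ ν : Measure E) [IsProbabilityMeasure μ] [IsProbabilityMeasure ν] :
    wasserstein p μ ν ^ p ≤
      ∫⁻ x, (radius M (shellIdx M (ρ x)) * ENNReal.ofReal (3 / 3 ^ K)) ^ p ∂μ +
      ∫⁻ x, (radius M (shellIdx M (ρ x)) * ENNReal.ofReal (3 / 3 ^ K)) ^ p ∂ν +
      ∑ k ∈ Finset.range K, ∑' i : ℕ × ℕ,
        (radius M i.1 * ENNReal.ofReal (3 ^ (k + 2) / 3 ^ K)) ^ p *
        ((μ (cell ρ M e N k ⁻¹' {i}) - ν (cell ρ M e N k ⁻¹' {i})) +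
          (ν (cell ρ M e N k ⁻¹' {i}) - μ (cell ρ M e N k ⁻¹' {i}))) := by
  -- From step `K` on the partition is made trivial.
  set f : ℕ → E → ℕ × ℕ := fun k x => if k < K then cell ρ M e N k x else 0 with hfdef
  have hf1 : ∀ k < K, f k = cell ρ M e N k := fun k hk => by ext1 x; simp [hfdef, hk]
  have hf2 : ∀ k, ¬ k < K → f k = fun _ => 0 := fun k hk => by ext1 x; simp [hfdef, hk]
  have hrm : Measurable fun x => radius M (shellIdx M (ρ x)) :=
    (measurable_of_countable (radius M)).comp ((measurable_shellIdx M).comp hρm)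
  have key := wasserstein_rpow_le (ι := ℕ × ℕ) hp μ ν (f := f) (K := K)
    (G := fun x => (radius M (shellIdx M (ρ x)) * ENNReal.ofReal (3 / 3 ^ K)) ^ p)
    (D := fun k i => (radius M i.1 * ENNReal.ofReal (3 ^ (k + 2) / 3 ^ K)) ^ p)
    ?_ ?_ ?_ ?_ ?_ ?_
  · refine key.trans (le_of_eq ?_)
    congr 1
    refine Finset.sum_congr rfl fun k hk => ?_
    rw [hf1 k (Finset.mem_range.1 hk)]
  · intro k
    by_cases hk : k < K
    · rw [hf1 k hk]; exact measurable_cell hρm M e N k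
    · rw [hf2 k hk]; exact measurable_const
  · intro k x y h
    by_cases hk : k + 1 < K
    · rw [hf1 k (by omega)] at h
      rw [hf1 _ hk]
      exact cell_succ_eq h
    · rw [hf2 _ hk]
  · intro x y
    rw [hf2 K (lt_irrefl K)]
  · exact (hrm.mul_const _).pow_const p
  · intro x y h
    rcases Nat.eq_zero_or_pos K with hK | hK
    · refine enorm_sub_rpow_le_add hρ hB M hp ?_ x y
      rw [hK]
      exact (ENNReal.le_ofReal_iff_toReal_le (by simp) (by norm_num)).2 (by norm_num)
    · rw [hf1 0 hK] at h
      refine le_trans (ENNReal.rpow_le_rpow ?_ hp.le) le_self_add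
      simpa using enorm_sub_le_of_cell_eq hρ hB heB he hK h
  · intro k hk x y h
    rw [hf1 k hk]
    by_cases hk1 : k + 1 < K
    · rw [hf1 _ hk1] at h
      exact le_trans (ENNReal.rpow_le_rpow (enorm_sub_le_of_cell_eq hρ hB heB he hk1 h) hp.le)
        le_self_add
    -- At the last step the scale factor is `3`, enough for the factor `2` of the triangle
    -- inequality.
    · refine enorm_sub_rpow_le_add hρ hB M hp ?_ x y
      refine (ENNReal.le_ofReal_iff_toReal_le (by simp) (by positivity)).2 ?_
      have : K = k + 1 := by omega
      rw [this, show k + 2 = k + 1 + 1 by rfl, pow_succ, mul_div_cancel_left₀ _ (by positivity)]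
      norm_num

end Gauge

/-! ### Covering centres and deviations of the empirical measure -/

/-- A finite internal covering number is attained by a family of centres indexed by integers. -/
theorem exists_centres {E : Type*} [PseudoMetricSpace E] {B : Set E} (hB : B.Nonempty) {r : ℝ≥0}
    (h : Metric.coveringNumber r B ≠ ⊤) :
    ∃ (e : ℕ → E) (N : ℕ), ((N + 1 : ℕ) : ℕ∞) = Metric.coveringNumber r B ∧ (∀ m, e m ∈ B) ∧
      ∀ x ∈ B, ∃ m ≤ N, dist x (e m) ≤ r := by
  obtain ⟨C, hCB, hCf, hC, hcard⟩ := Metric.exists_set_encard_eq_coveringNumber h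
  have hne : C.Nonempty := hC.nonempty hB
  have : Finite C := hCf
  have hpos : 0 < Nat.card C := by
    have : Nonempty C := hne.to_subtype
    exact Nat.card_pos
  set g := Finite.equivFin C
  refine ⟨fun m => if hm : m < Nat.card C then g.symm ⟨m, hm⟩ else g.symm ⟨0, hpos⟩,
    Nat.card C - 1, ?_, ?_, ?_⟩
  · rw [← hcard, Nat.sub_add_cancel hpos, Nat.card_coe_set_eq, hCf.cast_ncard_eq]
  · intro m
    dsimp only
    split_ifs <;> exact hCB (Subtype.coe_prop _)
  · intro x hx
    obtain ⟨y, hy, hxy⟩ := hC hx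
    refine ⟨g ⟨y, hy⟩, by have := (g ⟨y, hy⟩).2; omega, ?_⟩
    have hxy' : edist x y ≤ r := hxy
    dsimp only
    rw [dif_pos (g ⟨y, hy⟩).2]
    simp only [Fin.eta, Equiv.symm_apply_apply]
    rw [edist_dist] at hxy'
    exact (ENNReal.ofReal_le_iff_le_toReal (by simp)).1 hxy'

theorem isProbabilityMeasure_empiricalMeasure {E : Type*} [MeasurableSpace E] {n : ℕ} (hn : 0 < n)
    (x : Fin n → E) : IsProbabilityMeasure (empiricalMeasure x) := by
  constructor
  simp only [empiricalMeasure, Measure.smul_apply, Measure.coe_finsetSum, Finset.sum_apply,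
    measure_univ, Finset.sum_const, Finset.card_univ, Fintype.card_fin, smul_eq_mul, nsmul_eq_mul,
    mul_one]
  exact ENNReal.inv_mul_cancel (by exact_mod_cast hn.ne') (by simp)

theorem lintegral_empiricalMeasure {E : Type*} [MeasurableSpace E] {n : ℕ} (x : Fin n → E)
    {G : E → ℝ≥0∞} (hG : Measurable G) :
    ∫⁻ y, G y ∂(empiricalMeasure x) = (n : ℝ≥0∞)⁻¹ * ∑ i, G (x i) := by
  simp only [empiricalMeasure, lintegral_smul_measure, lintegral_finsetSum_measure,
    lintegral_dirac' _ hG, smul_eq_mul]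

theorem empiricalMeasure_apply {E : Type*} [MeasurableSpace E] {n : ℕ} (x : Fin n → E)
    {A : Set E} (hA : MeasurableSet A) :
    empiricalMeasure x A = (n : ℝ≥0∞)⁻¹ * ∑ i, A.indicator 1 (x i) := by
  simp [empiricalMeasure, Measure.dirac_apply' _ hA]

section Sample

variable {E Ω : Type*} [MeasurableSpace E] [MeasurableSpace Ω] {μ : Measure E}
  {P : Measure Ω} {n : ℕ} {X : Fin n → Ω → E}

theorem lintegral_lintegral_empiricalMeasure (hn : 0 < n) (hX : ∀ i, HasLaw (X i) μ P)
    {G : E → ℝ≥0∞} (hG : Measurable G) :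
    ∫⁻ ω, ∫⁻ y, G y ∂(empiricalMeasure fun i => X i ω) ∂P = ∫⁻ y, G y ∂μ := by
  simp_rw [lintegral_empiricalMeasure _ hG]
  have hm : ∀ i, AEMeasurable (fun ω => G (X i ω)) P :=
    fun i => hG.comp_aemeasurable (hX i).aemeasurable
  rw [lintegral_const_mul' _ _ (by simp [hn.ne']), lintegral_finsetSum' _ fun i _ => hm i]
  simp_rw [fun i => (hX i).lintegral_comp hG.aemeasurable]
  rw [Finset.sum_const, Finset.card_univ, Fintype.card_fin, nsmul_eq_mul, ← mul_assoc,
    ENNReal.inv_mul_cancel (by exact_mod_cast hn.ne') (by simp), one_mul]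

theorem aemeasurable_empiricalMeasure_apply (hX : ∀ i, HasLaw (X i) μ P) {A : Set E}
    (hA : MeasurableSet A) : AEMeasurable (fun ω => empiricalMeasure (fun i => X i ω) A) P := by
  simp_rw [empiricalMeasure_apply _ hA]
  exact (Finset.aemeasurable_fun_sum _ fun i _ =>
    ((measurable_one.indicator hA).comp_aemeasurable (hX i).aemeasurable)).const_mul _

theorem lintegral_empiricalMeasure_apply (hn : 0 < n) (hX : ∀ i, HasLaw (X i) μ P) {A : Set E}
    (hA : MeasurableSet A) : ∫⁻ ω, empiricalMeasure (fun i => X i ω) A ∂P = μ A := by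
  have := lintegral_lintegral_empiricalMeasure hn hX (measurable_one.indicator hA)
  simpa [lintegral_indicator_one hA] using this

theorem lintegral_le_sqrt_lintegral_sq [IsProbabilityMeasure P] {g : Ω → ℝ≥0∞}
    (hg : AEMeasurable g P) : ∫⁻ ω, g ω ∂P ≤ (∫⁻ ω, g ω ^ 2 ∂P) ^ (1 / 2 : ℝ) := by
  have := ENNReal.lintegral_mul_le_Lp_mul_Lq P Real.HolderConjugate.two_two hg
    (aemeasurable_const (b := (1 : ℝ≥0∞)))
  simpa using this

theorem sub_add_sub_eq_enorm {a b : ℝ} (ha : 0 ≤ a) (hb : 0 ≤ b) :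
    (ENNReal.ofReal a - ENNReal.ofReal b) + (ENNReal.ofReal b - ENNReal.ofReal a) =
      ‖a - b‖ₑ := by
  rw [← ENNReal.ofReal_sub _ hb, ← ENNReal.ofReal_sub _ ha, ← ofReal_norm, Real.norm_eq_abs]
  rcases le_total a b with h | h
  · rw [ENNReal.ofReal_of_nonpos (sub_nonpos.2 h), zero_add, abs_sub_comm,
      abs_of_nonneg (sub_nonneg.2 h)]
  · rw [ENNReal.ofReal_of_nonpos (sub_nonpos.2 h), add_zero, abs_of_nonneg (sub_nonneg.2 h)]

/-- The two truncated differences add up to the distance of a mean of `n` independent indicators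
from its expectation; its variance is at most `μ A / n`. -/
theorem lintegral_deviation_le_sqrt [IsProbabilityMeasure μ] [IsProbabilityMeasure P] (hn : 0 < n)
    (hX : ∀ i, HasLaw (X i) μ P) (hind : iIndepFun X P) {A : Set E} (hA : MeasurableSet A) :
    ∫⁻ ω, ((empiricalMeasure (fun i => X i ω) A - μ A) +
      (μ A - empiricalMeasure (fun i => X i ω) A)) ∂P ≤ (μ A / n) ^ (1 / 2 : ℝ) := by
  have hn0 : (0 : ℝ) < n := by exact_mod_cast hn
  set g : E → ℝ := A.indicator 1 with hgdef
  have hg : Measurable g := measurable_one.indicator hA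
  have hg01 : ∀ x, 0 ≤ g x ∧ g x ≤ 1 := fun x => by
    by_cases hx : x ∈ A <;> simp [hgdef, hx]
  set Z : Fin n → Ω → ℝ := fun i => g ∘ X i with hZ
  have hZm : ∀ i, AEMeasurable (Z i) P := fun i => hg.comp_aemeasurable (hX i).aemeasurable
  have hZL : ∀ i, MemLp (Z i) 2 P := fun i =>
    MemLp.of_bound (hZm i).aestronglyMeasurable 1 (ae_of_all _ fun ω => by
      rw [Real.norm_eq_abs, abs_le]
      exact ⟨neg_one_lt_zero.le.trans (hg01 (X i ω)).1, (hg01 (X i ω)).2⟩)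
  have hZi : ∀ i, ∫ ω, Z i ω ∂P = μ.real A := fun i => by
    rw [hZ, (hX i).integral_comp hg.aestronglyMeasurable, integral_indicator_one hA]
  have hvarZ : ∀ i, Var[Z i; P] ≤ μ.real A := fun i => by
    refine (variance_le_expectation_sq (hZm i).aestronglyMeasurable).trans (le_of_eq ?_)
    rw [← hZi i]
    refine integral_congr_ae (ae_of_all _ fun ω => ?_)
    by_cases hx : X i ω ∈ A <;> simp [hZ, hgdef, hx]
  set S : Ω → ℝ := (n : ℝ)⁻¹ • ∑ i, Z i with hS
  have hSL : MemLp S 2 P := (memLp_finsetSum' _ fun i _ => hZL i).const_smul _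
  have hSE : ∫ ω, S ω ∂P = μ.real A := by
    simp only [hS, Pi.smul_apply, Finset.sum_apply, smul_eq_mul]
    rw [integral_const_mul, integral_finsetSum _ fun i _ => (hZL i).integrable (by norm_num)]
    simp_rw [hZi]
    simp [hn0.ne']
  have hSV : Var[S; P] ≤ μ.real A / n := by
    rw [hS, variance_smul, IndepFun.variance_sum (fun i _ => hZL i)
      (fun i _ j _ hij => ((hind.comp (fun _ => g) fun _ => hg).indepFun hij))]
    calc (n : ℝ)⁻¹ ^ 2 * ∑ i, Var[Z i; P] ≤ (n : ℝ)⁻¹ ^ 2 * ∑ _i : Fin n, μ.real A := by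
          gcongr with i; exact hvarZ i
      _ = μ.real A / n := by
          rw [Finset.sum_const, Finset.card_univ, Fintype.card_fin, nsmul_eq_mul]; field_simp
  have hemp : ∀ ω, empiricalMeasure (fun i => X i ω) A = ENNReal.ofReal (S ω) := fun ω => by
    rw [empiricalMeasure_apply _ hA]
    simp only [hS, Pi.smul_apply, Finset.sum_apply, smul_eq_mul]
    rw [ENNReal.ofReal_mul (by positivity), ENNReal.ofReal_inv_of_pos hn0, ENNReal.ofReal_natCast,
      ENNReal.ofReal_sum_of_nonneg fun i _ => show 0 ≤ Z i ω from (hg01 _).1]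
    congr 1
    refine Finset.sum_congr rfl fun i _ => ?_
    by_cases hx : X i ω ∈ A <;> simp [hZ, hgdef, hx]
  have hS0 : ∀ ω, 0 ≤ S ω := fun ω => by
    simp only [hS, Pi.smul_apply, Finset.sum_apply, smul_eq_mul]
    exact mul_nonneg (by positivity) (Finset.sum_nonneg fun i _ => (hg01 _).1)
  have hμA : μ A = ENNReal.ofReal (μ.real A) := (ofReal_measureReal).symm
  calc _ = ∫⁻ ω, ‖S ω - ∫ ω, S ω ∂P‖ₑ ∂P := by
        rw [hSE]
        refine lintegral_congr fun ω => ?_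
        rw [hemp, hμA, sub_add_sub_eq_enorm (hS0 ω) measureReal_nonneg]
    _ ≤ (∫⁻ ω, ‖S ω - ∫ ω, S ω ∂P‖ₑ ^ 2 ∂P) ^ (1 / 2 : ℝ) :=
        lintegral_le_sqrt_lintegral_sq
          (hSL.aestronglyMeasurable.aemeasurable.sub_const _).enorm
    _ = (ENNReal.ofReal Var[S; P]) ^ (1 / 2 : ℝ) := by
        rw [ofReal_variance hSL, evariance]
    _ ≤ (μ A / n) ^ (1 / 2 : ℝ) := by
        refine ENNReal.rpow_le_rpow ?_ (by norm_num)
        refine (ENNReal.ofReal_le_ofReal hSV).trans (le_of_eq ?_)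
        rw [ENNReal.ofReal_div_of_pos hn0, ENNReal.ofReal_natCast, hμA]

theorem lintegral_deviation_le_two_mul (hn : 0 < n) (hX : ∀ i, HasLaw (X i) μ P)
    [IsProbabilityMeasure P] {A : Set E} (hA : MeasurableSet A) :
    ∫⁻ ω, ((empiricalMeasure (fun i => X i ω) A - μ A) +
      (μ A - empiricalMeasure (fun i => X i ω) A)) ∂P ≤ 2 * μ A := by
  calc _ ≤ ∫⁻ ω, (empiricalMeasure (fun i => X i ω) A + μ A) ∂P :=
        lintegral_mono fun ω => add_le_add tsub_le_self tsub_le_self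
    _ = 2 * μ A := by
        rw [lintegral_add_right _ measurable_const, lintegral_empiricalMeasure_apply hn hX hA]
        simp [two_mul]

/-- Cauchy–Schwarz. -/
theorem sum_sqrt_le (N : ℕ) (a : ℕ → ℝ≥0∞) :
    ∑ m ∈ Finset.range N, a m ^ (1 / 2 : ℝ) ≤
      (N * ∑ m ∈ Finset.range N, a m) ^ (1 / 2 : ℝ) := by
  have h := ENNReal.rpow_sum_le_const_mul_sum_rpow (Finset.range N)
    (fun m => a m ^ (1 / 2 : ℝ)) (p := 2) (by norm_num)
  simp_rw [← ENNReal.rpow_mul] at h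
  norm_num at h
  have h2 := ENNReal.rpow_le_rpow h (z := 1 / 2) (by norm_num)
  rw [← ENNReal.rpow_natCast, ← ENNReal.rpow_mul] at h2
  norm_num at h2
  simpa using h2

/-- The expected total deviation of the empirical measure over `N` disjoint sets. -/
theorem tsum_lintegral_deviation_le [IsProbabilityMeasure μ] [IsProbabilityMeasure P] (hn : 0 < n)
    (hX : ∀ i, HasLaw (X i) μ P) (hind : iIndepFun X P) {A : ℕ → Set E}
    (hA : ∀ m, MeasurableSet (A m)) (hd : Pairwise fun i j => Disjoint (A i) (A j)) {N : ℕ}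
    (hN : ∀ m, N ≤ m → A m = ∅) {S : Set E} (hS : ∀ m, A m ⊆ S) :
    ∑' m, ∫⁻ ω, ((empiricalMeasure (fun i => X i ω) (A m) - μ (A m)) +
      (μ (A m) - empiricalMeasure (fun i => X i ω) (A m))) ∂P ≤
      2 * min (μ S) ((N * μ S / n) ^ (1 / 2 : ℝ)) := by
  have hsum : ∑ m ∈ Finset.range N, μ (A m) ≤ μ S := by
    rw [← measure_biUnion_finset (fun i _ j _ hij => hd hij) fun m _ => hA m]
    exact measure_mono (Set.iUnion₂_subset fun m _ => hS m)
  rw [tsum_eq_sum (s := Finset.range N) fun m hm => by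
    rw [hN m (by simpa using hm)]; simp]
  rw [mul_min]
  refine le_min ?_ ?_
  · calc _ ≤ ∑ m ∈ Finset.range N, 2 * μ (A m) :=
          Finset.sum_le_sum fun m _ => lintegral_deviation_le_two_mul hn hX (hA m)
      _ ≤ _ := by rw [← Finset.mul_sum]; gcongr
  · calc _ ≤ ∑ m ∈ Finset.range N, (μ (A m) / n) ^ (1 / 2 : ℝ) :=
          Finset.sum_le_sum fun m _ => lintegral_deviation_le_sqrt hn hX hind (hA m)
      _ ≤ (N * ∑ m ∈ Finset.range N, μ (A m) / n) ^ (1 / 2 : ℝ) := sum_sqrt_le N _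
      _ ≤ (N * μ S / n) ^ (1 / 2 : ℝ) := by
          refine ENNReal.rpow_le_rpow ?_ (by norm_num)
          simp_rw [div_eq_mul_inv]
          rw [← Finset.sum_mul, mul_assoc]
          gcongr
      _ ≤ _ := le_mul_of_one_le_left zero_le one_le_two

end Sample

/-! ### Masses of the shells -/

theorem tsum_shells (F : ℕ → ℝ≥0∞) (h0 : F 0 = 0) : ∑' s, F s = ∑' j, F (j + 1) := by
  rw [tsum_eq_zero_add' ENNReal.summable, h0, zero_add]

theorem radius_succ_mul_rpow {p : ℝ} (hp : 0 < p) (M : ℝ≥0) (j : ℕ) (δ : ℝ≥0∞) :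
    (radius M (j + 1) * δ) ^ p = δ ^ p * (M : ℝ≥0∞) ^ p * 2 ^ (p * (j : ℝ)) := by
  rw [radius, ENNReal.mul_rpow_of_nonneg _ _ hp.le, ENNReal.mul_rpow_of_nonneg _ _ hp.le,
    ← ENNReal.rpow_natCast, ← ENNReal.rpow_mul, mul_comm (j : ℝ) p]
  ring

section ShellMass

variable {E : Type*} [MeasurableSpace E] {ρ : E → ℝ≥0∞} {μ : Measure E} {q : ℝ} {M : ℝ≥0}

theorem lintegral_rpow_eq (hq : 0 < q) (hM : (∫⁻ x, ρ x ^ q ∂μ) ^ (1 / q) = (M : ℝ≥0∞)) :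
    ∫⁻ x, ρ x ^ q ∂μ = (M : ℝ≥0∞) ^ q := by
  rw [← hM, ← ENNReal.rpow_mul, one_div, inv_mul_cancel₀ hq.ne', ENNReal.rpow_one]

theorem ae_gauge_eq_zero (hρm : Measurable ρ) (hq : 0 < q)
    (hM : (∫⁻ x, ρ x ^ q ∂μ) ^ (1 / q) = (M : ℝ≥0∞)) (h0 : M = 0) : ∀ᵐ x ∂μ, ρ x = 0 := by
  have h := lintegral_rpow_eq hq hM
  rw [h0, ENNReal.coe_zero, ENNReal.zero_rpow_of_pos hq,
    lintegral_eq_zero_iff (hρm.pow_const q)] at h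
  filter_upwards [h] with x hx
  simpa [ENNReal.rpow_eq_zero_iff, hq, hq.not_gt] using hx

/-- The finite `q`-th moment makes `ρ` finite almost everywhere; for `M = 0` it makes `ρ` vanish
almost everywhere. -/
theorem measure_shell_zero (hρm : Measurable ρ) (hq : 0 < q)
    (hM : (∫⁻ x, ρ x ^ q ∂μ) ^ (1 / q) = (M : ℝ≥0∞)) :
    μ {x | shellIdx M (ρ x) = 0} = 0 := by
  suffices h : ∀ᵐ x ∂μ, ¬ shellIdx M (ρ x) = 0 by simpa [ae_iff] using h
  rcases eq_or_ne M 0 with h0 | h0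
  · filter_upwards [ae_gauge_eq_zero hρm hq hM h0] with x hx
    rw [shellIdx_eq_zero_iff, hx]
    intro h
    exact absurd (h 0) not_lt_zero
  · have hfin : ∫⁻ x, ρ x ^ q ∂μ ≠ ∞ := by
      rw [lintegral_rpow_eq hq hM]; exact ENNReal.rpow_ne_top_of_nonneg hq.le (by simp)
    filter_upwards [ae_lt_top (hρm.pow_const q) hfin] with x hx
    rw [shellIdx_eq_zero_iff]
    intro h
    have hx' : ρ x ≠ ∞ := fun ht => by simp [ht, hq] at hx
    obtain ⟨j, hj⟩ := ENNReal.exists_nat_mul_gt (a := (M : ℝ≥0∞)) (by simpa using h0) hx'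
    refine lt_irrefl (ρ x) (hj.trans (lt_of_le_of_lt ?_ (h j)))
    gcongr
    exact_mod_cast Nat.lt_two_pow_self.le

/-- Markov's inequality at the inner radius `2^(j-1) M`; using it instead of the outer one costs
`2^q`. For `j = 0` a probability is at most `1`. -/
theorem measure_shell_succ_le [IsProbabilityMeasure μ] (hρm : Measurable ρ) (hq : 0 < q)
    (hM : (∫⁻ x, ρ x ^ q ∂μ) ^ (1 / q) = (M : ℝ≥0∞)) (j : ℕ) :
    μ {x | shellIdx M (ρ x) = j + 1} ≤ 2 ^ q * 2 ^ (-(q * (j : ℝ))) := by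
  cases j with
  | zero =>
    refine prob_le_one.trans ?_
    simpa using ENNReal.one_le_rpow one_le_two hq
  | succ j =>
    rcases eq_or_ne M 0 with h0 | h0
    · have : μ {x | shellIdx M (ρ x) = j + 1 + 1} = 0 := by
        suffices h : ∀ᵐ x ∂μ, ¬ shellIdx M (ρ x) = j + 1 + 1 by simpa [ae_iff] using h
        filter_upwards [ae_gauge_eq_zero hρm hq hM h0] with x hx
        rw [shellIdx_eq_succ_iff, hx]
        intro h
        exact absurd (h.2 0 (by omega)) not_lt_zero
      rw [this]; exact zero_le
    · have hsub : {x | shellIdx M (ρ x) = j + 1 + 1} ⊆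
          {x | ((2 : ℝ≥0∞) ^ j * M) ^ q ≤ ρ x ^ q} := by
        intro x hx
        rw [Set.mem_ofPred_eq, shellIdx_eq_succ_iff] at hx
        exact ENNReal.rpow_le_rpow (hx.2 j (by omega)).le hq.le
      have hmk := mul_meas_ge_le_lintegral (μ := μ) (hρm.pow_const q) (((2 : ℝ≥0∞) ^ j * M) ^ q)
      rw [lintegral_rpow_eq hq hM, ENNReal.mul_rpow_of_nonneg _ _ hq.le] at hmk
      have hM0 : (M : ℝ≥0∞) ^ q ≠ 0 := by simp [ENNReal.rpow_eq_zero_iff, h0]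
      have hMt : (M : ℝ≥0∞) ^ q ≠ ∞ := ENNReal.rpow_ne_top_of_nonneg hq.le (by simp)
      refine (measure_mono hsub).trans ?_
      rw [ENNReal.mul_rpow_of_nonneg _ _ hq.le]
      set m := μ {x | ((2 : ℝ≥0∞) ^ j) ^ q * (M : ℝ≥0∞) ^ q ≤ ρ x ^ q}
      have h1 : ((2 : ℝ≥0∞) ^ j) ^ q * m ≤ 1 := by
        rw [← ENNReal.mul_le_mul_iff_left hM0 hMt, one_mul]
        calc _ = ((2 : ℝ≥0∞) ^ j) ^ q * (M : ℝ≥0∞) ^ q * m := by ring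
          _ ≤ _ := hmk
      have h2 : ((2 : ℝ≥0∞) ^ j) ^ q = 2 ^ (q * (j : ℝ)) := by
        rw [← ENNReal.rpow_natCast, ← ENNReal.rpow_mul, mul_comm]
      rw [h2] at h1
      calc m = 2 ^ (-(q * (j : ℝ))) * (2 ^ (q * (j : ℝ)) * m) := by
            rw [← mul_assoc, ← ENNReal.rpow_add _ _ two_ne_zero ENNReal.ofNat_ne_top]
            simp
        _ ≤ 2 ^ (-(q * (j : ℝ))) * 1 := by gcongr
        _ = _ := by
          rw [mul_one, ← ENNReal.rpow_add _ _ two_ne_zero ENNReal.ofNat_ne_top]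
          congr 1; push_cast; ring

theorem lintegral_radius_rpow_le
    [IsProbabilityMeasure μ] {p : ℝ} (hρm : Measurable ρ) (hp : 0 < p) (hq : 0 < q)
    (hM : (∫⁻ x, ρ x ^ q ∂μ) ^ (1 / q) = (M : ℝ≥0∞)) (δ : ℝ≥0∞) :
    ∫⁻ x, (radius M (shellIdx M (ρ x)) * δ) ^ p ∂μ ≤
      2 ^ q * δ ^ p * (M : ℝ≥0∞) ^ p *
        ∑' j : ℕ, 2 ^ (p * (j : ℝ)) * 2 ^ (-(q * (j : ℝ))) := by
  rw [lintegral_comp_eq_tsum (f := fun x => shellIdx M (ρ x)) μ ((measurable_shellIdx M).comp hρm)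
    (fun s => (radius M s * δ) ^ p)]
  rw [tsum_shells]
  · rw [← ENNReal.tsum_mul_left]
    refine ENNReal.tsum_le_tsum fun j => ?_
    rw [radius_succ_mul_rpow hp]
    calc _ ≤ δ ^ p * (M : ℝ≥0∞) ^ p * 2 ^ (p * (j : ℝ)) * (2 ^ q * 2 ^ (-(q * (j : ℝ)))) := by
          gcongr; exact measure_shell_succ_le hρm hq hM j
      _ = _ := by ring
  · have := measure_shell_zero hρm hq hM
    rw [show (fun x => shellIdx M (ρ x)) ⁻¹' {0} = {x | shellIdx M (ρ x) = 0} from rfl, this,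
      mul_zero]

end ShellMass

/-! ### Expected transport cost -/

theorem scale_rpow {p : ℝ} (K l : ℕ) (hl : l ≤ K) :
    ENNReal.ofReal (3 ^ (K - l + 1) / 3 ^ K) ^ p = 3 ^ p * 3 ^ (-(p * (l : ℝ))) := by
  have h : ENNReal.ofReal (3 ^ (K - l + 1) / 3 ^ K) = 3 ^ (1 - (l : ℝ)) := by
    have e : (3 : ℝ) ^ (K - l + 1) / 3 ^ K = 3 ^ (1 - (l : ℝ)) := by
      rw [← Real.rpow_natCast, ← Real.rpow_natCast, ← Real.rpow_sub (by norm_num)]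
      congr 1; push_cast [Nat.cast_sub hl]; ring
    rw [e, ← ENNReal.ofReal_rpow_of_pos (by norm_num)]
    norm_num
  rw [h, ← ENNReal.rpow_mul, ← ENNReal.rpow_add _ _ (by norm_num) (by norm_num)]
  congr 1; ring

theorem min_mul_sqrt_le {a t m : ℝ≥0∞} (ha : 1 ≤ a) {N : ℝ≥0∞} {n : ℕ} (hm : m ≤ a * t) :
    min m ((N * m / n) ^ (1 / 2 : ℝ)) ≤ a * min t ((N * t / n) ^ (1 / 2 : ℝ)) := by
  rw [mul_min]
  refine min_le_min hm ?_
  calc (N * m / n) ^ (1 / 2 : ℝ) ≤ (a * (N * t / n)) ^ (1 / 2 : ℝ) := by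
        refine ENNReal.rpow_le_rpow ?_ (by norm_num)
        calc N * m / n ≤ N * (a * t) / n := by gcongr
          _ = a * (N * t / n) := by simp only [div_eq_mul_inv]; ring
    _ = a ^ (1 / 2 : ℝ) * (N * t / n) ^ (1 / 2 : ℝ) :=
        ENNReal.mul_rpow_of_nonneg _ _ (by norm_num)
    _ ≤ a * (N * t / n) ^ (1 / 2 : ℝ) := by
        gcongr
        simpa using ENNReal.rpow_le_rpow_of_exponent_le ha (show (1 / 2 : ℝ) ≤ 1 by norm_num)

section Expectation

variable {E Ω : Type*} [NormedAddCommGroup E] [NormedSpace ℝ E] [MeasurableSpace E] [BorelSpace E]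
  [MeasurableSpace Ω] {ρ : E → ℝ≥0∞} {μ : Measure E} [IsProbabilityMeasure μ] {p q : ℝ} {M : ℝ≥0}
  {P : Measure Ω} [IsProbabilityMeasure P] {n : ℕ} {X : Fin n → Ω → E}

theorem tsum_cell_deviation_le (hρm : Measurable ρ) (hp : 0 < p) (hq : 0 < q)
    (hM : (∫⁻ x, ρ x ^ q ∂μ) ^ (1 / q) = (M : ℝ≥0∞)) (hn : 0 < n)
    (hX : ∀ i, HasLaw (X i) μ P) (hind : iIndepFun X P) (e : ℕ → ℕ → E) (N : ℕ → ℕ) (k : ℕ)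
    (δ : ℝ≥0∞) :
    ∑' i : ℕ × ℕ, (radius M i.1 * δ) ^ p *
      ∫⁻ ω, ((empiricalMeasure (fun i => X i ω) (cell ρ M e N k ⁻¹' {i}) -
          μ (cell ρ M e N k ⁻¹' {i})) +
        (μ (cell ρ M e N k ⁻¹' {i}) -
          empiricalMeasure (fun i => X i ω) (cell ρ M e N k ⁻¹' {i}))) ∂P ≤
      2 * 2 ^ q * δ ^ p * (M : ℝ≥0∞) ^ p * ∑' j : ℕ, 2 ^ (p * (j : ℝ)) *
        min (2 ^ (-(q * (j : ℝ))))
          ((((N k + 1 : ℕ) : ℝ≥0∞) * 2 ^ (-(q * (j : ℝ))) / n) ^ (1 / 2 : ℝ)) := by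
  rw [ENNReal.tsum_prod']
  simp_rw [ENNReal.tsum_mul_left]
  -- Centres are numbered from `0` to `N k`, hence `N k + 1` cells per shell.
  have hdev : ∀ s, _ := fun s => tsum_lintegral_deviation_le hn hX hind
    (A := fun m => cell ρ M e N k ⁻¹' {(s, m)}) (N := N k + 1)
    (S := {x | shellIdx M (ρ x) = s})
    (fun m => measurable_cell hρm M e N k (measurableSet_singleton _))
    (fun i j hij => Disjoint.preimage _ (by simpa using hij))
    (fun m hm => by
      ext x
      simp only [cell, Set.mem_preimage, Set.mem_singleton_iff, Prod.mk.injEq,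
        Set.mem_empty_iff_false, iff_false, not_and]
      intro _ h
      have := nestedIdx_le e N k ((radius M (shellIdx M (ρ x))).toReal⁻¹ • x)
      omega)
    (fun m x hx => congrArg Prod.fst hx)
  refine (ENNReal.tsum_le_tsum fun s => mul_le_mul_right (hdev s) _).trans ?_
  rw [tsum_shells]
  · rw [← ENNReal.tsum_mul_left]
    refine ENNReal.tsum_le_tsum fun j => ?_
    rw [radius_succ_mul_rpow hp]
    refine (mul_le_mul_right (mul_le_mul_right (min_mul_sqrt_le (ENNReal.one_le_rpow one_le_two hq)
      (measure_shell_succ_le hρm hq hM j)) _) _).trans (le_of_eq ?_)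
    ring
  · rw [measure_shell_zero hρm hq hM]
    simp

theorem lintegral_wasserstein_le_cells (hρm : Measurable ρ)
    (hρ : ∀ (a : ℝ) (x : E), ρ (a • x) = ENNReal.ofReal |a| * ρ x)
    (hB : {x : E | ρ x ≤ 1} ⊆ Metric.closedBall 0 1) {e : ℕ → ℕ → E} {N : ℕ → ℕ} {K : ℕ}
    (heB : ∀ k < K, ∀ m, e k m ∈ {x | ρ x ≤ 1})
    (he : ∀ k < K, ∀ x ∈ {x | ρ x ≤ 1}, ∃ m ≤ N k, dist x (e k m) ≤ 3 ^ k / 3 ^ K)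
    (hp : 0 < p) (hq : 0 < q) (hM : (∫⁻ x, ρ x ^ q ∂μ) ^ (1 / q) = (M : ℝ≥0∞)) (hn : 0 < n)
    (hX : ∀ i, HasLaw (X i) μ P) (hind : iIndepFun X P) :
    ∫⁻ ω, wasserstein p (empiricalMeasure fun i => X i ω) μ ^ p ∂P ≤
      2 * 2 ^ q * ENNReal.ofReal (3 / 3 ^ K) ^ p * (M : ℝ≥0∞) ^ p *
        ∑' j : ℕ, 2 ^ (p * (j : ℝ)) * 2 ^ (-(q * (j : ℝ))) +
      ∑ k ∈ Finset.range K, 2 * 2 ^ q * ENNReal.ofReal (3 ^ (k + 2) / 3 ^ K) ^ p *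
        (M : ℝ≥0∞) ^ p * ∑' j : ℕ, 2 ^ (p * (j : ℝ)) *
          min (2 ^ (-(q * (j : ℝ))))
            ((((N k + 1 : ℕ) : ℝ≥0∞) * 2 ^ (-(q * (j : ℝ))) / n) ^ (1 / 2 : ℝ)) := by
  have hGm : Measurable fun x =>
      (radius M (shellIdx M (ρ x)) * ENNReal.ofReal (3 / 3 ^ K)) ^ p :=
    ((((measurable_of_countable (radius M)).comp
      ((measurable_shellIdx M).comp hρm)).mul_const _).pow_const p :)
  have hdm : ∀ (k : ℕ) (i : ℕ × ℕ), AEMeasurable (fun ω =>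
      ((empiricalMeasure (fun i => X i ω) (cell ρ M e N k ⁻¹' {i}) -
          μ (cell ρ M e N k ⁻¹' {i})) +
        (μ (cell ρ M e N k ⁻¹' {i}) -
          empiricalMeasure (fun i => X i ω) (cell ρ M e N k ⁻¹' {i})))) P := fun k i => by
    have h := aemeasurable_empiricalMeasure_apply hX
      (measurable_cell hρm M e N k (measurableSet_singleton i))
    exact (h.sub aemeasurable_const).add (aemeasurable_const.sub h)
  -- The pointwise bound is almost everywhere measurable, so the integral may be split after this
  -- step; measurability of the Wasserstein distance itself is not needed.
  refine (lintegral_mono (g := fun ω =>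
      ∫⁻ x, (radius M (shellIdx M (ρ x)) * ENNReal.ofReal (3 / 3 ^ K)) ^ p
        ∂(empiricalMeasure fun i => X i ω) +
      ∫⁻ x, (radius M (shellIdx M (ρ x)) * ENNReal.ofReal (3 / 3 ^ K)) ^ p ∂μ +
      ∑ k ∈ Finset.range K, ∑' i : ℕ × ℕ,
        (radius M i.1 * ENNReal.ofReal (3 ^ (k + 2) / 3 ^ K)) ^ p *
        ((empiricalMeasure (fun i => X i ω) (cell ρ M e N k ⁻¹' {i}) -
            μ (cell ρ M e N k ⁻¹' {i})) +
          (μ (cell ρ M e N k ⁻¹' {i}) -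
            empiricalMeasure (fun i => X i ω) (cell ρ M e N k ⁻¹' {i})))) fun ω => ?_).trans ?_
  · have := isProbabilityMeasure_empiricalMeasure hn fun i => X i ω
    exact wasserstein_rpow_le_cells hρm hρ hB M heB he hp _ _
  · have htm : ∀ k ∈ Finset.range K, AEMeasurable (fun ω => ∑' i : ℕ × ℕ,
        (radius M i.1 * ENNReal.ofReal (3 ^ (k + 2) / 3 ^ K)) ^ p *
        ((empiricalMeasure (fun i => X i ω) (cell ρ M e N k ⁻¹' {i}) -
            μ (cell ρ M e N k ⁻¹' {i})) +
          (μ (cell ρ M e N k ⁻¹' {i}) -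
            empiricalMeasure (fun i => X i ω) (cell ρ M e N k ⁻¹' {i})))) P := fun k _ =>
      AEMeasurable.tsum fun i => (hdm k i).const_mul _
    rw [lintegral_add_right' _ (Finset.aemeasurable_fun_sum _ htm),
      lintegral_add_right _ measurable_const, lintegral_finsetSum' _ htm,
      lintegral_lintegral_empiricalMeasure hn hX hGm, lintegral_const, measure_univ, mul_one,
      ← two_mul]
    refine add_le_add ?_ (Finset.sum_le_sum fun k _ => ?_)
    · refine (mul_le_mul_right (lintegral_radius_rpow_le hρm hp hq hM _) 2).trans (le_of_eq ?_)
      ring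
    · rw [lintegral_tsum fun i => (hdm k i).const_mul _]
      refine (le_of_eq (tsum_congr fun i => lintegral_const_mul'' _ (hdm k i))).trans ?_
      exact tsum_cell_deviation_le hρm hp hq hM hn hX hind e N k _

/-- The expected transport cost in terms of the covering numbers of the first `K` scales. -/
theorem lintegral_wasserstein_le_of_finite (hρm : Measurable ρ)
    (hρ : ∀ (a : ℝ) (x : E), ρ (a • x) = ENNReal.ofReal |a| * ρ x)
    (hB : {x : E | ρ x ≤ 1} ⊆ Metric.closedBall 0 1) {K : ℕ}
    (hK : ∀ l < K, coverNum {x : E | ρ x ≤ 1} l ≠ ∞)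
    (hp : 0 < p) (hq : 0 < q) (hM : (∫⁻ x, ρ x ^ q ∂μ) ^ (1 / q) = (M : ℝ≥0∞)) (hn : 0 < n)
    (hX : ∀ i, HasLaw (X i) μ P) (hind : iIndepFun X P) :
    ∫⁻ ω, wasserstein p (empiricalMeasure fun i => X i ω) μ ^ p ∂P ≤
      2 * 2 ^ q * 3 ^ p * (M : ℝ≥0∞) ^ p * ∑' j : ℕ, (2 : ℝ≥0∞) ^ (p * (j : ℝ)) *
        ((2 : ℝ≥0∞) ^ (-(q * (j : ℝ))) * (3 : ℝ≥0∞) ^ (-(p * (K : ℝ))) +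
          ∑ l ∈ Finset.range K, (3 : ℝ≥0∞) ^ (-(p * (l : ℝ))) *
            min ((2 : ℝ≥0∞) ^ (-(q * (j : ℝ))))
              ((coverNum {x : E | ρ x ≤ 1} l * (2 : ℝ≥0∞) ^ (-(q * (j : ℝ))) / (n : ℝ≥0∞)) ^
                (1 / 2 : ℝ))) := by
  have hne : {x : E | ρ x ≤ 1}.Nonempty := ⟨0, by simp [gauge_zero hρ]⟩
  -- Steps go from fine to coarse: step `k` uses level `K - 1 - k`, of radius `3^(-(K-k)) = 3^k /
  -- 3^K`.
  have hex : ∀ k, ∃ (e : ℕ → E) (N : ℕ), k < K →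
      ((N + 1 : ℕ) : ℝ≥0∞) = coverNum {x : E | ρ x ≤ 1} (K - 1 - k) ∧
      (∀ m, e m ∈ {x : E | ρ x ≤ 1}) ∧
      ∀ x ∈ {x : E | ρ x ≤ 1}, ∃ m ≤ N, dist x (e m) ≤ 3 ^ k / 3 ^ K := by
    intro k
    by_cases hk : k < K
    · have hfin := hK (K - 1 - k) (by omega)
      rw [coverNum, Ne, ENat.toENNReal_eq_top] at hfin
      obtain ⟨e, N, h1, h2, h3⟩ := exists_centres hne hfin
      refine ⟨e, N, fun _ => ⟨?_, h2, ?_⟩⟩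
      · rw [coverNum, ← h1]; rfl
      · have hr : (((3 : ℝ≥0)⁻¹ ^ (K - 1 - k + 1) : ℝ≥0) : ℝ) = 3 ^ k / 3 ^ K := by
          rw [show K - 1 - k + 1 = K - k by omega]
          push_cast
          rw [inv_pow, eq_div_iff (by positivity), inv_mul_eq_iff_eq_mul₀ (by positivity), ← pow_add,
            Nat.sub_add_cancel hk.le]
        rw [← hr]; exact h3
    · exact ⟨fun _ => 0, 0, fun h => absurd h hk⟩
  choose e N h using hex
  refine (lintegral_wasserstein_le_cells hρm hρ hB (fun k hk => (h k hk).2.1)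
    (fun k hk => (h k hk).2.2) hp hq hM hn hX hind).trans (le_of_eq ?_)
  simp_rw [mul_add, Finset.mul_sum]
  rw [ENNReal.tsum_add, mul_add, ← Finset.sum_range_reflect]
  congr 1
  · have := scale_rpow (p := p) K K le_rfl
    rw [Nat.sub_self, zero_add, pow_one] at this
    rw [this, ← ENNReal.tsum_mul_left, ← ENNReal.tsum_mul_left]
    refine tsum_congr fun j => ?_
    ring
  · rw [Summable.tsum_finsetSum fun i _ => ENNReal.summable, Finset.mul_sum]
    refine Finset.sum_congr rfl fun l hl => ?_
    have hl' := Finset.mem_range.1 hl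
    rw [(h (K - 1 - l) (by omega)).1, show K - 1 - (K - 1 - l) = l by omega,
      show K - 1 - l + 2 = K - l + 1 by omega, scale_rpow K l hl'.le,
      ← ENNReal.tsum_mul_left, ← ENNReal.tsum_mul_left]
    refine tsum_congr fun j => ?_
    ring

end Expectation

end WassersteinEmpirical

/-! ### Choice of the number of scales -/

open WassersteinEmpirical in
theorem mainTheorem1 (p q : ℝ) (hp : 1 ≤ p) (hpq : p < q) :
    ∃ c : ℝ≥0, ∀ (E : Type u) [NormedAddCommGroup E] [NormedSpace ℝ E] [CompleteSpace E]
      [MeasurableSpace E] [BorelSpace E]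
      (ρ : E → ℝ≥0∞) (_ : Measurable ρ)
      (_ : ∀ (a : ℝ) (x : E), ρ (a • x) = ENNReal.ofReal |a| * ρ x)
      (_ : {x : E | ρ x ≤ 1} ⊆ Metric.closedBall 0 1)
      (μ : Measure E) [IsProbabilityMeasure μ]
      (M : ℝ≥0) (_ : (∫⁻ x, ρ x ^ q ∂μ) ^ (1 / q) = (M : ℝ≥0∞))
      (Ω : Type v) [MeasurableSpace Ω] (P : Measure Ω) [IsProbabilityMeasure P]
      (n : ℕ) (_ : 0 < n) (X : Fin n → Ω → E)
      (_ : ∀ i, HasLaw (X i) μ P) (_ : iIndepFun X P) (L : ℕ),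
      ∫⁻ ω, WassersteinEmpirical.wasserstein p
          (WassersteinEmpirical.empiricalMeasure fun i => X i ω) μ ^ p ∂P ≤
        (c : ℝ≥0∞) * (M : ℝ≥0∞) ^ p * ∑' j : ℕ, (2 : ℝ≥0∞) ^ (p * (j : ℝ)) *
          ((2 : ℝ≥0∞) ^ (-(q * (j : ℝ))) * (3 : ℝ≥0∞) ^ (-(p * (L : ℝ))) +
            ∑ l ∈ Finset.range (L + 1), (3 : ℝ≥0∞) ^ (-(p * (l : ℝ))) *
              min ((2 : ℝ≥0∞) ^ (-(q * (j : ℝ))))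
                ((WassersteinEmpirical.coverNum {x : E | ρ x ≤ 1} l *
                  (2 : ℝ≥0∞) ^ (-(q * (j : ℝ))) / (n : ℝ≥0∞)) ^ (1 / 2 : ℝ))) := by
  classical
  have hp0 : 0 < p := by linarith
  have hq0 : 0 < q := by linarith
  -- `2` comes from the two measures, `2^q` from Markov's inequality, `3^p` from the cell diameters
  -- `3^(1-ℓ)` relative to `3^(-ℓ)`.
  refine ⟨2 * 2 ^ q * 3 ^ p, ?_⟩
  intro E _ _ _ _ _ ρ hρm hρ hB μ _ M hM Ω _ P _ n hn X hX hind L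
  have hc : ((2 * 2 ^ q * 3 ^ p : ℝ≥0) : ℝ≥0∞) = 2 * 2 ^ q * 3 ^ p := by
    push_cast
    rw [ENNReal.coe_rpow_of_nonneg _ hq0.le, ENNReal.coe_rpow_of_nonneg _ hp0.le]
    rfl
  rw [hc]
  by_cases h : ∃ l, l ≤ L ∧ coverNum {x : E | ρ x ≤ 1} l = ∞
  · have hfind := Nat.find_spec h
    have hmin : ∀ l < Nat.find h, coverNum {x : E | ρ x ≤ 1} l ≠ ∞ := fun l hl hl' =>
      Nat.find_min h hl ⟨hl.le.trans hfind.1, hl'⟩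
    -- Stop before the first level `K` without a finite cover. There the minimum equals `2^(-qj)`,
    -- so the summand `ℓ = K` absorbs the finest-scale term.
    set K := Nat.find h
    refine (lintegral_wasserstein_le_of_finite hρm hρ hB hmin hp0 hq0 hM hn hX hind).trans ?_
    refine mul_le_mul' le_rfl (ENNReal.tsum_le_tsum fun j => mul_le_mul' le_rfl ?_)
    refine le_trans ?_ le_add_self
    refine le_trans (le_of_eq ?_) (Finset.sum_le_sum_of_subset
      (Finset.range_subset_range.2 (Nat.succ_le_succ hfind.1)))
    rw [Finset.sum_range_succ, add_comm, mul_comm ((2 : ℝ≥0∞) ^ (-(q * (j : ℝ))))]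
    congr 2
    have h2 : (2 : ℝ≥0∞) ^ (-(q * (j : ℝ))) ≠ 0 := by
      simp [ENNReal.rpow_eq_zero_iff]
    rw [hfind.2, ENNReal.top_mul h2, ENNReal.top_div_of_ne_top (by simp),
      ENNReal.top_rpow_of_pos (by norm_num), min_eq_left le_top]
  · have hfin : ∀ l < L + 1, coverNum {x : E | ρ x ≤ 1} l ≠ ∞ := fun l hl hl' =>
      h ⟨l, by omega, hl'⟩
    -- All `L + 1` levels are used, and `3^(-p(L+1)) ≤ 3^(-pL)`.
    refine (lintegral_wasserstein_le_of_finite hρm hρ hB hfin hp0 hq0 hM hn hX hind).trans ?_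
    gcongr
    · norm_num
    · simp
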